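/- Let $\mathbb{E}$ be a regular category, that is, a finitely complete category in which every kernel pair has a coequalizer and regular epimorphisms are stable under pullback. Then the following two conditions are equivalent. (1) $\mathbb{E}$ is a Mal'tsev category, i.e. every internal reflexive relation in $\mathbb{E}$ is an internal equivalence relation. (2) For all split epimorphisms with given sections $f'\colon X'\to Y'$, $s'\colon Y'\to X'$, $f's'=1_{Y'}$, and $f\colon X\to Y$, $s\colon Y\to X$, $fs=1_Y$, and all regular epimorphisms $x\colon X'\to X$ and $y\colon Y'\to Y$ with $fx=yf'$ and $xs'=sy$, the commutative square $fx=yf'$ is a regular pushout, i.e. the comparison map $(x,f')\colon X'\to X\times_Y Y'$ to the pullback of $f$ along $y$ is a regular epimorphism. -/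

import Mathlib

open CategoryTheory CategoryTheory.Limits

universe v u

/-- A category is a Mal'tsev category if it is finitely complete and every (internal) reflexive
relation in it is an (internal) equivalence relation. -/
class IsMaltsevCategory (E : Type u) [Category.{v} E] : Prop extends HasFiniteLimits E where
  isEquivalenceRelation_of_reflexive :
    ∀ {R X : E} (d₀ d₁ : R ⟶ X), ReflexiveRelation d₀ d₁ → IsEquivalenceRelation d₀ d₁

/-- An object of the category `Pt E`: a split epimorphism `f : X ⟶ Y` equipped with a
given section `s`. -/
structure Pt (E : Type u) [Category.{v} E] where
  /-- the domain of the split epimorphism -/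
  X : E
  /-- the codomain of the split epimorphism -/
  Y : E
  /-- the split epimorphism -/
  f : X ⟶ Y
  /-- the given section -/
  s : Y ⟶ X
  section_comp : s ≫ f = 𝟙 Y

namespace Pt

variable {E : Type u} [Category.{v} E]

/-- A morphism of split epimorphisms: a pair of morphisms commuting both with the split
epimorphisms and with the given sections. -/
@[ext]
structure Hom (A B : Pt E) where
  /-- the upper horizontal arrow -/
  x : A.X ⟶ B.X
  /-- the lower horizontal arrow -/
  y : A.Y ⟶ B.Y
  comm_f : x ≫ B.f = A.f ≫ y
  comm_s : A.s ≫ x = y ≫ B.s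

/-- The category of split epimorphisms with a given section. -/
instance : Category (Pt E) where
  Hom := Hom
  id A := { x := 𝟙 A.X, y := 𝟙 A.Y, comm_f := by simp, comm_s := by simp }
  comp φ ψ :=
    { x := φ.x ≫ ψ.x
      y := φ.y ≫ ψ.y
      comm_f := by rw [Category.assoc, ψ.comm_f, ← Category.assoc, φ.comm_f, Category.assoc]
      comm_s := by rw [← Category.assoc, φ.comm_s, Category.assoc, ψ.comm_s, Category.assoc] }
  id_comp φ := Hom.ext (Category.id_comp φ.x) (Category.id_comp φ.y)
  comp_id φ := Hom.ext (Category.comp_id φ.x) (Category.comp_id φ.y)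
  assoc φ ψ χ := Hom.ext (Category.assoc φ.x ψ.x χ.x) (Category.assoc φ.y ψ.y χ.y)

/-- For a morphism `(x, y) : (f', s') ⟶ (f, s)` of split epimorphisms, the comparison map from
the domain `X'` of `f'` to the pullback of `f` along `y`, with components `x` and `f'`. -/
noncomputable def comparison [HasPullbacks E] {A B : Pt E} (φ : A ⟶ B) :
    A.X ⟶ pullback B.f φ.y :=
  pullback.lift φ.x A.f φ.comm_f

/-- The square underlying a morphism of split epimorphisms is a regular pushout if the
comparison map to the pullback is a regular epimorphism. -/
def IsRegularPushout [HasPullbacks E] {A B : Pt E} (φ : A ⟶ B) : Prop :=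
  IsRegularEpi (comparison φ)

end Pt

/-! Both conditions amount to difunctionality of every relation. If it holds, let the image of `(x,
f')` be viewed as a relation from `X` to `Y'`: a zigzag built from the sections shows that it fills
the pullback. Conversely, for a relation `D`, the zigzags in `D` form a pullback of split
epimorphisms, and those that close up form a subobject which is the comparison map of a suitable
square. A monic regular epimorphism is invertible, so every zigzag closes up. -/

namespace Maltsev

variable {E : Type u} [Category.{v} E]

attribute [local simp] prod.lift_fst prod.lift_snd prod.lift_fst_assoc prod.lift_snd_assoc
  pullback.lift_fst pullback.lift_snd pullback.lift_fst_assoc pullback.lift_snd_assoc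

/-- A span `p : D ⟶ A`, `q : D ⟶ B` is difunctional if, in terms of generalized elements,
`a D b`, `a' D b` and `a' D b'` imply `a D b'`. -/
def IsDifunctional {D A B : E} (p : D ⟶ A) (q : D ⟶ B) : Prop :=
  ∀ ⦃T : E⦄ (d₁ d₂ d₃ : T ⟶ D), d₁ ≫ q = d₂ ≫ q → d₂ ≫ p = d₃ ≫ p →
    ∃ d : T ⟶ D, d ≫ p = d₁ ≫ p ∧ d ≫ q = d₃ ≫ q

lemma mono_prod_lift [HasFiniteLimits E] {D A B : E} {p : D ⟶ A} {q : D ⟶ B}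
    (h : JointlyMono₂ p q) : Mono (prod.lift p q) where
  right_cancellation f g hfg := by
    refine h.right_cancellation f g ?_ ?_
    · simpa using hfg =≫ prod.fst
    · simpa using hfg =≫ prod.snd

/-- In a Mal'tsev category every relation is difunctional. The relation
`(a, b) ∼ (a', b')` iff `a D b'` on `D` is reflexive, hence symmetric. -/
theorem isDifunctional_of_jointlyMono [IsMaltsevCategory E] {D A B : E} {p : D ⟶ A} {q : D ⟶ B}
    (h : JointlyMono₂ p q) : IsDifunctional p q := by
  intro T d₁ d₂ d₃ h₁₂ h₂₃
  have := mono_prod_lift h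
  let k := pullback.snd (prod.lift p q) (prod.map p q)
  have hk : pullback.fst (prod.lift p q) (prod.map p q) ≫ prod.lift p q = k ≫ prod.map p q :=
    pullback.condition
  have hfst : pullback.fst (prod.lift p q) (prod.map p q) ≫ p = k ≫ prod.fst ≫ p := by
    simpa using hk =≫ prod.fst
  have hsnd : pullback.fst (prod.lift p q) (prod.map p q) ≫ q = k ≫ prod.snd ≫ q := by
    simpa using hk =≫ prod.snd
  have refl : ReflexiveRelation (k ≫ prod.fst) (k ≫ prod.snd) :=
    { right_cancellation := fun Y f g h₁ h₂ ↦ by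
        rw [← cancel_mono k]
        apply Limits.prod.hom_ext <;> simpa
      r := pullback.lift (𝟙 D) (prod.lift (𝟙 D) (𝟙 D)) (by simp)
      reflexivity₁ := by simp [k]
      reflexivity₂ := by simp [k] }
  obtain ⟨⟨e⟩⟩ := IsMaltsevCategory.isEquivalenceRelation_of_reflexive _ _ refl
  -- `d₂` witnesses `d₃ ∼ d₁`; a witness of the symmetric `d₁ ∼ d₃` is the required element.
  let t : T ⟶ pullback (prod.lift p q) (prod.map p q) :=
    pullback.lift d₂ (prod.lift d₃ d₁) (by
      apply Limits.prod.hom_ext <;> simp [h₁₂, h₂₃])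
  have htk : t ≫ k = prod.lift d₃ d₁ := pullback.lift_snd _ _ _
  refine ⟨t ≫ e.s ≫ pullback.fst _ _, ?_, ?_⟩
  · have := e.symmetry₁
    rw [Category.assoc, Category.assoc, hfst, reassoc_of% this, reassoc_of% htk]
    simp
  · have := e.symmetry₂
    rw [Category.assoc, Category.assoc, hsnd, reassoc_of% this, reassoc_of% htk]
    simp

/-- A reflexive difunctional relation is an equivalence relation. -/
theorem isEquivalenceRelation_of_isDifunctional [HasPullbacks E] {R X : E} {d₀ d₁ : R ⟶ X}
    (e : ReflexiveRelation d₀ d₁) (h : IsDifunctional d₀ d₁) : IsEquivalenceRelation d₀ d₁ := by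
  -- For `x R y`, the zigzag `(y, y)`, `(x, y)`, `(x, x)` yields `y R x`.
  obtain ⟨s, hs₀, hs₁⟩ := h (d₁ ≫ e.r) (𝟙 R) (d₀ ≫ e.r) (by simp) (by simp)
  -- The zigzag `(x, y)`, `(y, y)`, `(y, z)` yields `x R z`.
  obtain ⟨t, ht₀, ht₁⟩ := h (pullback.fst d₁ d₀) (pullback.fst d₁ d₀ ≫ d₁ ≫ e.r)
    (pullback.snd d₁ d₀) (by simp) (by simp [pullback.condition])
  exact ⟨⟨{
    e with
    s := s
    symmetry₁ := by simpa using hs₀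
    symmetry₂ := by simpa using hs₁
    c := _
    isLimit := pullbackIsPullback d₁ d₀
    t := t
    transitivity₁ := ht₀
    transitivity₂ := ht₁ }⟩⟩

/-- In a regular Mal'tsev category, a morphism of split epimorphisms whose upper component is a
regular epimorphism is a regular pushout. -/
theorem isRegularPushout_of_isMaltsevCategory [Regular E] [IsMaltsevCategory E] {A B : Pt E}
    (φ : A ⟶ B) (hx : IsRegularEpi φ.x) : Pt.IsRegularPushout φ := by
  let F := Regular.strongEpiMonoFactorisation (Pt.comparison φ)
  have hF : F.e ≫ F.m = Pt.comparison φ := F.fac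
  have hFx : F.e ≫ F.m ≫ pullback.fst B.f φ.y = φ.x := by
    rw [← Category.assoc, hF]; exact pullback.lift_fst _ _ _
  have hFf : F.e ≫ F.m ≫ pullback.snd B.f φ.y = A.f := by
    rw [← Category.assoc, hF]; exact pullback.lift_snd _ _ _
  have hm : JointlyMono₂ (F.m ≫ pullback.fst B.f φ.y) (F.m ≫ pullback.snd B.f φ.y) :=
    ⟨fun Y f g h₁ h₂ ↦ by
      rw [← cancel_mono F.m]
      apply pullback.hom_ext <;> simpa⟩
  let a := pullback.fst φ.x (pullback.fst B.f φ.y)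
  let π := pullback.snd φ.x (pullback.fst B.f φ.y)
  have haπ : a ≫ φ.x = π ≫ pullback.fst B.f φ.y := pullback.condition
  have hc : pullback.fst B.f φ.y ≫ B.f = pullback.snd B.f φ.y ≫ φ.y := pullback.condition
  -- For `(x a, y')` in the pullback, the images of `a`, `s' f' a` and `s' y'` form a zigzag, since
  -- `x s' f' a = s f x a = s y y' = x s' y'`. It closes up at `(x a, y')`.
  obtain ⟨d, hd₁, hd₂⟩ := isDifunctional_of_jointlyMono hm (a ≫ F.e) (a ≫ A.f ≫ A.s ≫ F.e)
    (π ≫ pullback.snd B.f φ.y ≫ A.s ≫ F.e)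
    (by simp only [Category.assoc, hFf, A.section_comp, Category.comp_id])
    (by
      simp only [Category.assoc, hFx, φ.comm_s]
      rw [← reassoc_of% φ.comm_f, reassoc_of% haπ, reassoc_of% hc])
  have hd : d ≫ F.m = π := by
    apply pullback.hom_ext
    · simpa [hFx, haπ] using hd₁
    · simpa [hFf, A.section_comp] using hd₂
  have hπ : IsRegularEpi π := inferInstanceAs (IsRegularEpi (pullback.snd φ.x _))
  -- The regular epimorphism `π` factors through the monomorphism `F.m`.
  have : IsIso F.m := ExtremalEpi.isIso π d F.m hd
  have he : IsRegularEpi F.e := inferInstanceAs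
    (IsRegularEpi (Regular.strongEpiMonoFactorisation (Pt.comparison φ)).e)
  rw [Pt.IsRegularPushout, ← hF]
  exact (MorphismProperty.cancel_right_of_respectsIso (.regularEpi E) F.e F.m).2 he

/-- If all morphisms of split epimorphisms with regular epimorphic components are regular
pushouts, then every relation is difunctional. -/
theorem isDifunctional_of_isRegularPushout [HasFiniteLimits E]
    (H : ∀ (A B : Pt E) (φ : A ⟶ B), IsRegularEpi φ.x → IsRegularEpi φ.y → Pt.IsRegularPushout φ)
    {D A B : E} {p : D ⟶ A} {q : D ⟶ B} (h : JointlyMono₂ p q) : IsDifunctional p q := by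
  have := mono_prod_lift h
  -- `P` consists of the triples `a D b`, `a' D b`, `a' D b'`.
  let P := pullback (pullback.snd q q) (pullback.fst p p)
  let u : P ⟶ pullback q q := pullback.fst _ _
  let w : P ⟶ pullback p p := pullback.snd _ _
  have huw : u ≫ pullback.snd q q = w ≫ pullback.fst p p := pullback.condition
  -- `j` is the subobject of `P` of those triples for which moreover `a D b'`.
  let c : P ⟶ A ⨯ B := prod.lift (u ≫ pullback.fst q q ≫ p) (w ≫ pullback.snd p p ≫ q)
  let j := pullback.snd (prod.lift p q) c
  -- `σ` and `τ` send `(d₁, d₂)` to `(d₁, d₂, d₂)` and `(d₂, d₃)` to `(d₂, d₂, d₃)`. These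
  -- degenerate zigzags are closed up by `d₁` and `d₃`, so both maps lift through `j`.
  let σ : pullback q q ⟶ P := pullback.lift (𝟙 _) (pullback.snd q q ≫ pullback.diagonal p)
    (by simp)
  have hσu : σ ≫ u = 𝟙 _ := pullback.lift_fst _ _ _
  have hσw : σ ≫ w = pullback.snd q q ≫ pullback.diagonal p := pullback.lift_snd _ _ _
  let τ : pullback p p ⟶ P := pullback.lift (pullback.fst p p ≫ pullback.diagonal q) (𝟙 _)
    (by simp)
  have hτu : τ ≫ u = pullback.fst p p ≫ pullback.diagonal q := pullback.lift_fst _ _ _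
  have hτw : τ ≫ w = 𝟙 _ := pullback.lift_snd _ _ _
  let σ' : pullback q q ⟶ pullback (prod.lift p q) c := pullback.lift (pullback.fst q q) σ (by
    apply Limits.prod.hom_ext
    · simp [c, reassoc_of% hσu]
    · simp [c, reassoc_of% hσw, pullback.condition])
  have hσ' : σ' ≫ j = σ := pullback.lift_snd _ _ _
  let τ' : pullback p p ⟶ pullback (prod.lift p q) c := pullback.lift (pullback.snd p p) τ (by
    apply Limits.prod.hom_ext
    · simp [c, reassoc_of% hτu, pullback.condition]
    · simp [c, reassoc_of% hτw])
  have hτ' : τ' ≫ j = τ := pullback.lift_snd _ _ _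
  let S' : Pt E :=
    { X := pullback (prod.lift p q) c
      Y := pullback p p
      f := j ≫ w
      s := τ'
      section_comp := by rw [reassoc_of% hτ', hτw] }
  let S : Pt E :=
    { X := pullback q q
      Y := D
      f := pullback.snd q q
      s := pullback.diagonal q
      section_comp := by simp }
  let φ : S' ⟶ S := Pt.Hom.mk (A := S') (B := S) (j ≫ u) (pullback.fst p p)
    (by simp [S', S, huw])
    (by simp [S', S, reassoc_of% hτ', hτu])
  have hx : IsSplitEpi (j ≫ u) := ⟨⟨σ', by rw [reassoc_of% hσ', hσu]⟩⟩
  have hy : IsSplitEpi (pullback.fst p p) := ⟨⟨pullback.diagonal p, by simp⟩⟩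
  have hreg : IsRegularEpi (Pt.comparison φ) := H S' S φ
    (inferInstanceAs (IsRegularEpi (j ≫ u))) (inferInstanceAs (IsRegularEpi (pullback.fst p p)))
  have hj : Pt.comparison φ = j := by
    apply pullback.hom_ext
    · exact pullback.lift_fst _ _ _
    · exact pullback.lift_snd _ _ _
  have hreg' : IsRegularEpi j := hj ▸ hreg
  have : Mono j := inferInstanceAs (Mono (pullback.snd (prod.lift p q) c))
  have : IsIso j := isIso_of_mono_of_strongEpi j
  intro T d₁ d₂ d₃ h₁₂ h₂₃
  let t : T ⟶ P := pullback.lift (pullback.lift d₁ d₂ h₁₂) (pullback.lift d₂ d₃ h₂₃) (by simp)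
  have htu : t ≫ u = pullback.lift d₁ d₂ h₁₂ := pullback.lift_fst _ _ _
  have htw : t ≫ w = pullback.lift d₂ d₃ h₂₃ := pullback.lift_snd _ _ _
  have hd : (t ≫ inv j ≫ pullback.fst (prod.lift p q) c) ≫ prod.lift p q = t ≫ c := by
    rw [Category.assoc, Category.assoc, pullback.condition, IsIso.inv_hom_id_assoc]
  refine ⟨t ≫ inv j ≫ pullback.fst (prod.lift p q) c, ?_, ?_⟩
  · simpa [c, reassoc_of% htu] using hd =≫ prod.fst
  · simpa [c, reassoc_of% htw] using hd =≫ prod.snd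

end Maltsev

theorem mainTheorem8 (E : Type u) [Category.{v} E] [Regular E] :
    IsMaltsevCategory E ↔
      ∀ (A B : Pt E) (φ : A ⟶ B), IsRegularEpi φ.x → IsRegularEpi φ.y →
        Pt.IsRegularPushout φ := by
  refine ⟨fun _ A B φ hx _ ↦ Maltsev.isRegularPushout_of_isMaltsevCategory φ hx, fun H ↦ ?_⟩
  exact
    { isEquivalenceRelation_of_reflexive := fun d₀ d₁ e ↦
        Maltsev.isEquivalenceRelation_of_isDifunctional e
          (Maltsev.isDifunctional_of_isRegularPushout H e.toJointlyMono₂) }
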